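/- Let $M=(0,1)^3$ and, for $\epsilon\in[0,\tfrac12)$, let $G_{3,\epsilon}$ be the piecewise affine map of the cube \[ (G_{3,\epsilon}(x))_i=2(1-\epsilon)x_i+2\epsilon (B_3(x))_i-h(x_i),\qquad i=1,2,3, \] where $h(u)=\lfloor u+\tfrac12\rfloor$ if $u\notin\tfrac12+\mathbb{Z}$, $h(u)=0$ otherwise, and \[ \begin{aligned} (B_{3}(x))_1&=\tfrac14\big(2h(x_1)-h(x_2)+h(x_1+x_2)-h(x_2+x_3)+h(x_1+x_2+x_3)\big),\\ (B_{3}(x))_2&=\tfrac14\big(2h(x_2)-h(x_1)-h(x_3)+h(x_1+x_2)+h(x_2+x_3)\big),\\ (B_{3}(x))_3&=\tfrac14\big(2h(x_3)-h(x_2)-h(x_1+x_2)+h(x_2+x_3)+h(x_1+x_2+x_3)\big). \end{aligned} \] For a word $\omega$ of six integers, let the atom $A_\omega$ be the open set of those $x\in M$ such that none of $x_1,x_2,x_3,x_1+x_2,x_2+x_3,x_1+x_2+x_3$ lies in $\tfrac12+\mathbb{Z}$ and the values of $h$ at these six numbers form $\omega$; the atoms cover $M$ up to a null set. Let $\{\cdot\}$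 denote the coordinatewise fractional part, and let \[ \sigma_{2134}(x)=\{(-x_1,\,x_1+x_2,\,x_3)\},\quad \sigma_{1324}(x)=\{(x_1+x_2,\,-x_2,\,x_2+x_3)\},\quad \sigma_{3124}=\sigma_{2134}\circ\sigma_{1324},\quad \Sigma(x)=(1-x_1,1-x_2,1-x_3). \] A polytope is a bounded intersection of finitely many open half-spaces. A polytope $P\subset M$ solves the conditioning problem for $G_{3,\epsilon}$ if * $P\cap A_\omega\neq\emptyset$ iff $\omega\in\{000000,000001,000101\}$; * $G_{3,\epsilon}(P\cap A_{000000})\subset P\cap A_{000101}$, $G_{3,\epsilon}(P\cap A_{000001})\subset\sigma_{3124}(P)$ and $G_{3,\epsilon}(P\cap A_{000101})\subset\sigma_{2134}(P)$. A set $U$ is an invariant union of polytopes (IUP) of $G_{3,\epsilon}$ if it is a union of finitely many polytopes contained in $M$ and $G_{3,\epsilon}(U\cap A_\omega)\subset U$ for every atom $A_\omega$; it is an asymmetric IUP (AsIUP) if moreover $\Sigma(U)\cap U=\emptyset$. Let $p^*=\frac{2-\epsilon}{2(3-2\epsilon)}$, $p_1^*=1-p^*$, $p_2^*=1-2p^*$,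 $p_3^*=1-3p^*$, and let $P$ be the set of all $x\in\mathbb{R}^3$ such that \[ \tfrac{\epsilon}{2}<x_2,\quad 0<x_3,\quad \tfrac{\epsilon}{2}(3-2\epsilon)<x_1+x_2,\quad x_1+2x_2+3x_3<1,\quad p_1^*x_1+p_2^*x_2+p_3^*x_3<p_2^*,\quad -p^*x_1+p_2^*x_2+p_3^*x_3<0 . \] **Statement.** For $\epsilon\in[0,\tfrac12)$, the set $P$ is nonempty and solves the conditioning problem for $G_{3,\epsilon}$ if and only if $\epsilon\in\left[\tfrac{5-\sqrt{17}}{2},\tfrac12\right)$. In this case, the orbit of $P$ under the group $\langle\sigma_{2134},\sigma_{1324}\rangle$ consists of exactly six sets, and their union $\mathrm{Orb}_{\langle\sigma_{2134},\sigma_{1324}\rangle}(P)$ is an AsIUP of $G_{3,\epsilon}$. -/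

import Mathlib

open scoped BigOperators

namespace CoupledMaps

noncomputable section

/-- Points of `ℝ³`; the coordinates `x₁, x₂, x₃` are `x 0, x 1, x 2`. -/
abbrev Pt : Type := Fin 3 → ℝ

/-- The phase space `M = (0,1)³`. -/
def cube : Set Pt := {x | ∀ i, 0 < x i ∧ x i < 1}

/-- `h u = ⌊u + 1/2⌋` if `u ∉ 1/2 + ℤ`, and `h u = 0` if `u ∈ 1/2 + ℤ`. -/
def h (u : ℝ) : ℤ :=
  open Classical in if ∃ k : ℤ, u = 1 / 2 + k then 0 else ⌊u + 1 / 2⌋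

/-- The piecewise constant function `B₃`. -/
def B₃ (x : Pt) : Pt :=
  ![(2 * h (x 0) - h (x 1) + h (x 0 + x 1) - h (x 1 + x 2) + h (x 0 + x 1 + x 2)) / 4,
    (2 * h (x 1) - h (x 0) - h (x 2) + h (x 0 + x 1) + h (x 1 + x 2)) / 4,
    (2 * h (x 2) - h (x 1) - h (x 0 + x 1) + h (x 1 + x 2) + h (x 0 + x 1 + x 2)) / 4]

/-- The reduced coupled map `G_{3,ε}`. -/
def G₃ (ε : ℝ) (x : Pt) : Pt :=
  fun i => 2 * (1 - ε) * x i + 2 * ε * B₃ x i - h (x i)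

/-- The six sums `x₁, x₂, x₃, x₁+x₂, x₂+x₃, x₁+x₂+x₃`. -/
def sums (x : Pt) : Fin 6 → ℝ :=
  ![x 0, x 1, x 2, x 0 + x 1, x 1 + x 2, x 0 + x 1 + x 2]

/-- The atom `A_ω`: the points of the cube at which no sum lies on a discontinuity `1/2 + ℤ` of `h`
and at which the values of `h` at the six sums form the word `ω`. Words that are not the label of
an atom give the empty set. -/
def atom (ω : Fin 6 → ℤ) : Set Pt :=
  {x | x ∈ cube ∧ ∀ j, (ω j : ℝ) - 1 / 2 < sums x j ∧ sums x j < (ω j : ℝ) + 1 / 2}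

/-- On `A_ω` the function `h` takes the values `ω`. -/
theorem h_eq_of_mem_atom {ω : Fin 6 → ℤ} {x : Pt} (hx : x ∈ atom ω) (j : Fin 6) :
    h (sums x j) = ω j := by
  obtain ⟨h1, h2⟩ := hx.2 j
  have hne : ¬ ∃ k : ℤ, sums x j = 1 / 2 + k := by
    rintro ⟨k, hk⟩
    rw [hk] at h1 h2
    have a : (ω j : ℝ) < k + 1 := by linarith
    have b : (k : ℝ) < ω j := by linarith
    have a' : ω j < k + 1 := by exact_mod_cast a
    have b' : k < ω j := by exact_mod_cast b
    omega
  unfold h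
  rw [if_neg hne, Int.floor_eq_iff]
  constructor <;> linarith

/-- The symmetry `σ_{2134}`, `x ↦ {-x₁, x₁+x₂, x₃}` (fractional parts of the coordinates). -/
def σ2134 (x : Pt) : Pt :=
  ![Int.fract (-x 0), Int.fract (x 0 + x 1), Int.fract (x 2)]

/-- The symmetry `σ_{1324}`, `x ↦ {x₁+x₂, -x₂, x₂+x₃}` (fractional parts of the coordinates). -/
def σ1324 (x : Pt) : Pt :=
  ![Int.fract (x 0 + x 1), Int.fract (-x 1), Int.fract (x 1 + x 2)]

/-- The symmetry `σ_{3124} = σ_{2134} ∘ σ_{1324}`. -/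
def σ3124 : Pt → Pt := σ2134 ∘ σ1324

/-- The inversion `Σ = 1 - Id`. -/
def inversion (x : Pt) : Pt := fun i => 1 - x i

/-- The orbit of `P` under `⟨σ_{2134}, σ_{1324}⟩`, as the collection of all images of `P`. Both
generators are involutions of the fundamental domain `[0,1)³`, so that the compositions of
generators already form the group that they generate there. -/
def orbitSets (P : Set Pt) : Set (Set Pt) :=
  {Q | ∃ g ∈ Submonoid.closure ({σ2134, σ1324} : Set (Function.End Pt)), Q = g '' P}

/-- The orbit set `Orb_{⟨σ_{2134}, σ_{1324}⟩}(P)`, the union of all images of `P`. -/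
def Orb (P : Set Pt) : Set Pt := ⋃₀ orbitSets P

/-- (Open, convex) polytopes: bounded intersections of finitely many open half-spaces. -/
def IsPolytope (P : Set Pt) : Prop :=
  Bornology.IsBounded P ∧
    ∃ (n : ℕ) (a : Fin n → Pt) (b : Fin n → ℝ), P = {x | ∀ k, ∑ i, a k i * x i < b k}

/-- Invariant unions of polytopes for `G_{3,ε}`. The map is considered on the union of the atoms,
which is the cube up to a set of measure zero. -/
def IsIUP (ε : ℝ) (U : Set Pt) : Prop :=
  (∃ C : Set (Set Pt), C.Finite ∧ (∀ Q ∈ C, IsPolytope Q ∧ Q ⊆ cube) ∧ U = ⋃₀ C) ∧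
    ∀ ω, G₃ ε '' (U ∩ atom ω) ⊆ U

/-- Asymmetric invariant unions of polytopes. -/
def IsAsIUP (ε : ℝ) (U : Set Pt) : Prop :=
  IsIUP ε U ∧ inversion '' U ∩ U = ∅

/-- The conditioning problem for the second bifurcation of `G_{3,ε}`. -/
structure SolvesConditioningProblem (ε : ℝ) (P : Set Pt) : Prop where
  isPolytope : IsPolytope P
  subset_cube : P ⊆ cube
  localization : ∀ ω : Fin 6 → ℤ, (P ∩ atom ω).Nonempty ↔
    ω ∈ ({![0, 0, 0, 0, 0, 0], ![0, 0, 0, 0, 0, 1], ![0, 0, 0, 1, 0, 1]} : Set (Fin 6 → ℤ))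
  image_000000 : G₃ ε '' (P ∩ atom ![0, 0, 0, 0, 0, 0]) ⊆ P ∩ atom ![0, 0, 0, 1, 0, 1]
  image_000001 : G₃ ε '' (P ∩ atom ![0, 0, 0, 0, 0, 1]) ⊆ σ3124 '' P
  image_000101 : G₃ ε '' (P ∩ atom ![0, 0, 0, 1, 0, 1]) ⊆ σ2134 '' P

/-- `p* = (2 - ε) / (2 (3 - 2 ε))`. -/
def pStar (ε : ℝ) : ℝ := (2 - ε) / (2 * (3 - 2 * ε))

/-- The explicit polytope `P`, as an open polytope. -/
def polytopeP (ε : ℝ) : Set Pt :=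
  {x | ε / 2 < x 1 ∧
    0 < x 2 ∧
    ε / 2 * (3 - 2 * ε) < x 0 + x 1 ∧
    x 0 + 2 * x 1 + 3 * x 2 < 1 ∧
    (1 - pStar ε) * x 0 + (1 - 2 * pStar ε) * x 1 + (1 - 3 * pStar ε) * x 2
      < 1 - 2 * pStar ε ∧
    -pStar ε * x 0 + (1 - 2 * pStar ε) * x 1 + (1 - 3 * pStar ε) * x 2 < 0}

end

end CoupledMaps

namespace CoupledMaps

/-! ### The piecewise affine map on atoms -/

/-! For ε > 2/5, P lies in a simplex on which the two generators act, via the affine maps `branch`,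
as S₃ permuting six disjoint copies of it. `G₃` commutes with this action, so the orbit is invariant
once the images of the three pieces of P are controlled.

On each of the pieces 000001 and 000101, `G₃` followed by the inverse symmetry is an affine
expansion whose inequalities come from the faces of P and from the discontinuities
(`preimage000001_mem`, `preimage000101_mem`).

On 000000, `G₃` is the homothety of ratio 2(1-ε), and the threshold arises here. The fifth face is
the critical one: on this piece its left side has supremum (1-ε)(4-ε)/2, approached at ((1-ε)/2,
ε/2, 0), and it must stay at most 1 for the scaled point to remain in P. This is ε² - 5ε + 2 ≤ 0,
sufficient by `scaled_mem_polytopeP` and necessary by `discriminant_of_solves`.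

Asymmetry comes from x₁ + 2x₂ + 3x₃, which `inversion` turns into 3 minus itself while P keeps it
below 1. -/

theorem h_eq_of_lt {u : ℝ} {n : ℤ} (h1 : (n : ℝ) - 1 / 2 < u) (h2 : u < n + 1 / 2) :
    h u = n := by
  have hne : ¬ ∃ k : ℤ, u = 1 / 2 + k := by
    rintro ⟨k, rfl⟩
    have a : n < k + 1 := by exact_mod_cast (by linarith : (n : ℝ) < k + 1)
    have b : k < n := by exact_mod_cast (by linarith : (k : ℝ) < n)
    omega
  unfold h
  rw [if_neg hne, Int.floor_eq_iff]
  constructor <;> linarith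

/-- The points of `ℝ³` at which `h` takes the values `w` at the six sums, away from the
discontinuities. -/
def HasWord (w : Fin 6 → ℤ) (x : Pt) : Prop :=
  ∀ j, (w j : ℝ) - 1 / 2 < sums x j ∧ sums x j < (w j : ℝ) + 1 / 2

theorem HasWord.h_eq {w : Fin 6 → ℤ} {x : Pt} (hx : HasWord w x) (j : Fin 6) :
    h (sums x j) = w j :=
  h_eq_of_lt (hx j).1 (hx j).2

theorem HasWord.G₃_eq {w : Fin 6 → ℤ} {x : Pt} (hx : HasWord w x) (ε : ℝ) :
    G₃ ε x =
      ![2 * (1 - ε) * x 0 + ε / 2 * (2 * w 0 - w 1 + w 3 - w 4 + w 5) - w 0,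
        2 * (1 - ε) * x 1 + ε / 2 * (2 * w 1 - w 0 - w 2 + w 3 + w 4) - w 1,
        2 * (1 - ε) * x 2 + ε / 2 * (2 * w 2 - w 1 - w 3 + w 4 + w 5) - w 2] := by
  have e0 : h (x 0) = w 0 := hx.h_eq 0
  have e1 : h (x 1) = w 1 := hx.h_eq 1
  have e2 : h (x 2) = w 2 := hx.h_eq 2
  have e3 : h (x 0 + x 1) = w 3 := hx.h_eq 3
  have e4 : h (x 1 + x 2) = w 4 := hx.h_eq 4
  have e5 : h (x 0 + x 1 + x 2) = w 5 := hx.h_eq 5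
  funext i
  fin_cases i <;> simp [G₃, B₃, e0, e1, e2, e3, e4, e5] <;> ring

theorem hasWord_iff {w : Fin 6 → ℤ} {x : Pt} :
    HasWord w x ↔
      ((w 0 : ℝ) - 1 / 2 < x 0 ∧ x 0 < w 0 + 1 / 2) ∧
      ((w 1 : ℝ) - 1 / 2 < x 1 ∧ x 1 < w 1 + 1 / 2) ∧
      ((w 2 : ℝ) - 1 / 2 < x 2 ∧ x 2 < w 2 + 1 / 2) ∧
      ((w 3 : ℝ) - 1 / 2 < x 0 + x 1 ∧ x 0 + x 1 < w 3 + 1 / 2) ∧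
      ((w 4 : ℝ) - 1 / 2 < x 1 + x 2 ∧ x 1 + x 2 < w 4 + 1 / 2) ∧
      ((w 5 : ℝ) - 1 / 2 < x 0 + x 1 + x 2 ∧ x 0 + x 1 + x 2 < w 5 + 1 / 2) := by
  refine ⟨fun hx => ⟨hx 0, hx 1, hx 2, hx 3, hx 4, hx 5⟩, fun ⟨h0, h1, h2, h3, h4, h5⟩ j => ?_⟩
  fin_cases j
  exacts [h0, h1, h2, h3, h4, h5]

theorem sums_ne_of_mem_atom {ω : Fin 6 → ℤ} {x : Pt} (hx : x ∈ atom ω) (j : Fin 6) (k : ℤ) :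
    sums x j ≠ k + 1 / 2 := by
  intro e
  obtain ⟨h1, h2⟩ := hx.2 j
  rw [e] at h1 h2
  have a : ω j < k + 1 := by exact_mod_cast (by linarith : (ω j : ℝ) < k + 1)
  have b : k < ω j := by exact_mod_cast (by linarith : (k : ℝ) < ω j)
  omega

/-! ### The symmetries on the fundamental simplex -/

/-- A fundamental domain of the symmetry group generated by `σ2134` and `σ1324`. -/
def simplex : Set Pt := {x | 0 < x 0 ∧ 0 < x 1 ∧ 0 < x 2 ∧ x 0 + x 1 + x 2 < 1}

/-- The affine maps that coincide with the six symmetries on `simplex`, in the order `id`, `σ2134`,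
`σ1324`, `σ2134 ∘ σ1324`, `σ1324 ∘ σ2134`, `σ2134 ∘ σ1324 ∘ σ2134`. -/
def branch (k : Fin 6) (x : Pt) : Pt :=
  ![![x 0, x 1, x 2],
    ![1 - x 0, x 0 + x 1, x 2],
    ![x 0 + x 1, 1 - x 1, x 1 + x 2],
    ![1 - x 0 - x 1, x 0, x 1 + x 2],
    ![x 1, 1 - x 0 - x 1, x 0 + x 1 + x 2],
    ![1 - x 1, 1 - x 0, x 0 + x 1 + x 2]] k

/-- The inverses of the affine maps `branch`. -/
def branchInv (k : Fin 6) (y : Pt) : Pt :=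
  ![![y 0, y 1, y 2],
    ![1 - y 0, y 0 + y 1 - 1, y 2],
    ![y 0 + y 1 - 1, 1 - y 1, y 1 + y 2 - 1],
    ![y 1, 1 - y 0 - y 1, y 0 + y 1 + y 2 - 1],
    ![1 - y 0 - y 1, y 0, y 1 + y 2 - 1],
    ![1 - y 1, 1 - y 0, y 0 + y 1 + y 2 - 2]] k

theorem branch_zero (x : Pt) : branch 0 x = x := by
  funext i
  fin_cases i <;> rfl

theorem branchInv_branch (k : Fin 6) (x : Pt) : branchInv k (branch k x) = x := by
  funext i
  fin_cases k <;> fin_cases i <;> simp [branch, branchInv] <;> ring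

theorem branch_branchInv (k : Fin 6) (y : Pt) : branch k (branchInv k y) = y := by
  funext i
  fin_cases k <;> fin_cases i <;> simp [branch, branchInv] <;> ring

theorem fract_eq_of {u v : ℝ} (n : ℤ) (e : u = v + n) (h0 : 0 ≤ v) (h1 : v < 1) :
    Int.fract u = v := by
  rw [e, Int.fract_add_intCast, Int.fract_eq_self.2 ⟨h0, h1⟩]

theorem fract_vec {a b c a' b' c' : ℝ} (ha : Int.fract a = a') (hb : Int.fract b = b')
    (hc : Int.fract c = c') : ![Int.fract a, Int.fract b, Int.fract c] = ![a', b', c'] := by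
  rw [ha, hb, hc]

/-- The table is left multiplication by `σ2134` in S₃, in the order of elements fixed in `branch`.
-/
theorem σ2134_branch (k : Fin 6) {x : Pt} (hx : x ∈ simplex) :
    σ2134 (branch k x) = branch (![1, 0, 3, 2, 5, 4] k) x := by
  obtain ⟨h0, h1, h2, h3⟩ := hx
  fin_cases k
  · exact fract_vec (fract_eq_of (-1) (by simp [branch]; try ring) (by linarith) (by linarith))
      (fract_eq_of 0 (by simp [branch]; try ring) (by linarith) (by linarith))
      (fract_eq_of 0 (by simp [branch]; try ring) (by linarith) (by linarith))
  · exact fract_vec (fract_eq_of (-1) (by simp [branch]; try ring) (by linarith) (by linarith))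
      (fract_eq_of 1 (by simp [branch]; try ring) (by linarith) (by linarith))
      (fract_eq_of 0 (by simp [branch]; try ring) (by linarith) (by linarith))
  · exact fract_vec (fract_eq_of (-1) (by simp [branch]; try ring) (by linarith) (by linarith))
      (fract_eq_of 1 (by simp [branch]; try ring) (by linarith) (by linarith))
      (fract_eq_of 0 (by simp [branch]; try ring) (by linarith) (by linarith))
  · exact fract_vec (fract_eq_of (-1) (by simp [branch]; try ring) (by linarith) (by linarith))
      (fract_eq_of 0 (by simp [branch]; try ring) (by linarith) (by linarith))
      (fract_eq_of 0 (by simp [branch]; try ring) (by linarith) (by linarith))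
  · exact fract_vec (fract_eq_of (-1) (by simp [branch]; try ring) (by linarith) (by linarith))
      (fract_eq_of 0 (by simp [branch]; try ring) (by linarith) (by linarith))
      (fract_eq_of 0 (by simp [branch]; try ring) (by linarith) (by linarith))
  · exact fract_vec (fract_eq_of (-1) (by simp [branch]; try ring) (by linarith) (by linarith))
      (fract_eq_of 1 (by simp [branch]; try ring) (by linarith) (by linarith))
      (fract_eq_of 0 (by simp [branch]; try ring) (by linarith) (by linarith))

theorem σ1324_branch (k : Fin 6) {x : Pt} (hx : x ∈ simplex) :
    σ1324 (branch k x) = branch (![2, 4, 0, 5, 1, 3] k) x := by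
  obtain ⟨h0, h1, h2, h3⟩ := hx
  fin_cases k
  · exact fract_vec (fract_eq_of 0 (by simp [branch]; try ring) (by linarith) (by linarith))
      (fract_eq_of (-1) (by simp [branch]; try ring) (by linarith) (by linarith))
      (fract_eq_of 0 (by simp [branch]; try ring) (by linarith) (by linarith))
  · exact fract_vec (fract_eq_of 1 (by simp [branch]; try ring) (by linarith) (by linarith))
      (fract_eq_of (-1) (by simp [branch]; try ring) (by linarith) (by linarith))
      (fract_eq_of 0 (by simp [branch]; try ring) (by linarith) (by linarith))
  · exact fract_vec (fract_eq_of 1 (by simp [branch]; try ring) (by linarith) (by linarith))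
      (fract_eq_of (-1) (by simp [branch]; try ring) (by linarith) (by linarith))
      (fract_eq_of 1 (by simp [branch]; try ring) (by linarith) (by linarith))
  · exact fract_vec (fract_eq_of 0 (by simp [branch]; try ring) (by linarith) (by linarith))
      (fract_eq_of (-1) (by simp [branch]; try ring) (by linarith) (by linarith))
      (fract_eq_of 0 (by simp [branch]; try ring) (by linarith) (by linarith))
  · exact fract_vec (fract_eq_of 0 (by simp [branch]; try ring) (by linarith) (by linarith))
      (fract_eq_of (-1) (by simp [branch]; try ring) (by linarith) (by linarith))
      (fract_eq_of 1 (by simp [branch]; try ring) (by linarith) (by linarith))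
  · exact fract_vec (fract_eq_of 1 (by simp [branch]; try ring) (by linarith) (by linarith))
      (fract_eq_of (-1) (by simp [branch]; try ring) (by linarith) (by linarith))
      (fract_eq_of 1 (by simp [branch]; try ring) (by linarith) (by linarith))

theorem branch_mem_cube (k : Fin 6) {x : Pt} (hx : x ∈ simplex) : branch k x ∈ cube := by
  obtain ⟨h0, h1, h2, h3⟩ := hx
  intro i
  fin_cases k <;> fin_cases i <;> simp [branch] <;> constructor <;> linarith

theorem σ3124_eq_branch {x : Pt} (hx : x ∈ simplex) : σ3124 x = branch 3 x := by
  have e1 := σ1324_branch 0 hx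
  have e2 := σ2134_branch 2 hx
  rw [branch_zero] at e1
  simp only [σ3124, Function.comp_apply, e1]
  exact e2

theorem σ2134_eq_branch {x : Pt} (hx : x ∈ simplex) : σ2134 x = branch 1 x := by
  have e := σ2134_branch 0 hx
  rwa [branch_zero] at e

theorem orbitSets_eq {P : Set Pt} (hP : P ⊆ simplex) :
    orbitSets P = Set.range fun k => branch k '' P := by
  ext Q
  constructor
  · rintro ⟨g, hg, rfl⟩
    have key : ∃ k, Set.EqOn g (branch k) simplex := by
      induction hg using Submonoid.closure_induction_left with
      | one => exact ⟨0, fun x _ => (branch_zero x).symm⟩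
      | mul_left s hs y _ ih =>
        obtain ⟨k, hk⟩ := ih
        rcases hs with rfl | rfl
        · exact ⟨_, fun x hx => (congrArg σ2134 (hk hx)).trans (σ2134_branch k hx)⟩
        · exact ⟨_, fun x hx => (congrArg σ1324 (hk hx)).trans (σ1324_branch k hx)⟩
    obtain ⟨k, hk⟩ := key
    exact ⟨k, (Set.image_congr fun x hx => hk (hP hx)).symm⟩
  · rintro ⟨k, rfl⟩
    let S : Submonoid (Function.End Pt) :=
      Submonoid.closure ({σ2134, σ1324} : Set (Function.End Pt))
    have key : ∀ k, ∃ g ∈ S, Set.EqOn g (branch k) simplex := by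
      have ha : (σ2134 : Function.End Pt) ∈ S := Submonoid.subset_closure (Or.inl rfl)
      have hb : (σ1324 : Function.End Pt) ∈ S := Submonoid.subset_closure (Or.inr rfl)
      have stepa : ∀ k, (∃ g ∈ S, Set.EqOn g (branch k) simplex) →
          ∃ g ∈ S, Set.EqOn g (branch (![1, 0, 3, 2, 5, 4] k)) simplex := by
        rintro k ⟨g, hg, e⟩
        exact ⟨_, S.mul_mem ha hg,
          fun x hx => (congrArg σ2134 (e hx)).trans (σ2134_branch k hx)⟩
      have stepb : ∀ k, (∃ g ∈ S, Set.EqOn g (branch k) simplex) →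
          ∃ g ∈ S, Set.EqOn g (branch (![2, 4, 0, 5, 1, 3] k)) simplex := by
        rintro k ⟨g, hg, e⟩
        exact ⟨_, S.mul_mem hb hg,
          fun x hx => (congrArg σ1324 (e hx)).trans (σ1324_branch k hx)⟩
      have h0 : ∃ g ∈ S, Set.EqOn g (branch 0) simplex :=
        ⟨1, S.one_mem, fun x _ => (branch_zero x).symm⟩
      have h1 := stepa 0 h0
      have h2 := stepb 0 h0
      have h3 := stepa 2 h2
      have h4 := stepb 1 h1
      have h5 := stepa 4 h4
      intro k
      fin_cases k
      exacts [h0, h1, h2, h3, h4, h5]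
    obtain ⟨g, hg, e⟩ := key k
    exact ⟨g, hg, Set.image_congr fun x hx => (e (hP hx)).symm⟩

theorem branch_ne_branch {k l : Fin 6} (hkl : k ≠ l) {x z : Pt} (hx : x ∈ simplex)
    (hz : z ∈ simplex) : branch k x ≠ branch l z := by
  obtain ⟨h0, h1, h2, h3⟩ := hx
  obtain ⟨g0, g1, g2, g3⟩ := hz
  intro e
  have e0 := congrFun e 0
  have e1 := congrFun e 1
  have e2 := congrFun e 2
  fin_cases k <;> fin_cases l <;> first
    | exact hkl rfl
    | (simp [branch] at e0 e1 e2; linarith)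

theorem ncard_orbitSets {P : Set Pt} (hP : P ⊆ simplex) (hne : P.Nonempty) :
    (orbitSets P).ncard = 6 := by
  have inj : Function.Injective fun k => branch k '' P := by
    intro k l e
    by_contra hkl
    obtain ⟨x, hx⟩ := hne
    have e' : branch k '' P = branch l '' P := e
    obtain ⟨z, hz, hzx⟩ : branch k x ∈ branch l '' P := e' ▸ Set.mem_image_of_mem _ hx
    exact branch_ne_branch hkl (hP hx) (hP hz) hzx.symm
  rw [orbitSets_eq hP, ← Set.image_univ, Set.ncard_image_of_injective _ inj, Set.ncard_univ]
  simp

theorem Orb_eq {P : Set Pt} (hP : P ⊆ simplex) : Orb P = ⋃ k, branch k '' P := by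
  rw [Orb, orbitSets_eq hP, Set.sUnion_range]

/-! ### Polytopes -/

theorem isBounded_cube : Bornology.IsBounded cube := by
  refine (Metric.isBounded_Icc (0 : Pt) 1).subset fun x hx => ?_
  exact ⟨fun i => (hx i).1.le, fun i => (hx i).2.le⟩

theorem IsPolytope.preimage {P : Set Pt} (hP : IsPolytope P) {f : Pt → Pt}
    (M : Fin 3 → Fin 3 → ℝ) (v : Pt) (hf : ∀ y i, f y i = ∑ j, M i j * y j + v i)
    (hb : Bornology.IsBounded (f ⁻¹' P)) : IsPolytope (f ⁻¹' P) := by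
  obtain ⟨-, n, a, b, rfl⟩ := hP
  refine ⟨hb, n, fun k j => ∑ i, a k i * M i j, fun k => b k - ∑ i, a k i * v i, ?_⟩
  ext y
  simp only [Set.mem_preimage, Set.mem_ofPred_eq, hf, Fin.sum_univ_three]
  refine forall_congr' fun k => ?_
  constructor <;> intro h' <;> linarith

theorem IsPolytope.image_branch {P : Set Pt} (hP : IsPolytope P) (hs : P ⊆ simplex) (k : Fin 6) :
    IsPolytope (branch k '' P) := by
  have e : branch k '' P = branchInv k ⁻¹' P := by
    ext y
    constructor
    · rintro ⟨x, hx, rfl⟩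
      rwa [Set.mem_preimage, branchInv_branch]
    · exact fun hy => ⟨_, hy, branch_branchInv k y⟩
  have hb : Bornology.IsBounded (branch k '' P) := by
    refine isBounded_cube.subset ?_
    rintro _ ⟨x, hx, rfl⟩
    exact branch_mem_cube k (hs hx)
  rw [e] at hb ⊢
  refine hP.preimage (fun i j => branchInv k (Pi.single j 1) i - branchInv k 0 i)
    (branchInv k 0) (fun y i => ?_) hb
  fin_cases k <;> fin_cases i <;> simp [branchInv, Fin.sum_univ_three] <;> ring

/-! ### The polytope `P` -/

/-- Multiplying the last two faces by 2(3-2ε) > 0 clears p* and leaves coefficients polynomial in ε.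
-/
theorem mem_polytopeP_iff {ε : ℝ} (hε : ε < 1 / 2) {x : Pt} :
    x ∈ polytopeP ε ↔ ε / 2 < x 1 ∧ 0 < x 2 ∧ ε / 2 * (3 - 2 * ε) < x 0 + x 1 ∧
      x 0 + 2 * x 1 + 3 * x 2 < 1 ∧
      (4 - 3 * ε) * x 0 + 2 * (1 - ε) * x 1 - ε * x 2 < 2 * (1 - ε) ∧
      -(2 - ε) * x 0 + 2 * (1 - ε) * x 1 - ε * x 2 < 0 := by
  have hd : 0 < 2 * (3 - 2 * ε) := by linarith
  have hp : pStar ε * (2 * (3 - 2 * ε)) = 2 - ε := by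
    rw [pStar, div_mul_cancel₀ _ hd.ne']
  have h5 : (1 - pStar ε) * x 0 + (1 - 2 * pStar ε) * x 1 + (1 - 3 * pStar ε) * x 2
      < 1 - 2 * pStar ε ↔
      (4 - 3 * ε) * x 0 + 2 * (1 - ε) * x 1 - ε * x 2 < 2 * (1 - ε) := by
    rw [← mul_lt_mul_iff_left₀ hd]
    have e1 : ((1 - pStar ε) * x 0 + (1 - 2 * pStar ε) * x 1 + (1 - 3 * pStar ε) * x 2) *
        (2 * (3 - 2 * ε)) = (4 - 3 * ε) * x 0 + 2 * (1 - ε) * x 1 - ε * x 2 := by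
      linear_combination (-x 0 - 2 * x 1 - 3 * x 2) * hp
    have e2 : (1 - 2 * pStar ε) * (2 * (3 - 2 * ε)) = 2 * (1 - ε) := by
      linear_combination (-2) * hp
    rw [e1, e2]
  have h6 : -pStar ε * x 0 + (1 - 2 * pStar ε) * x 1 + (1 - 3 * pStar ε) * x 2 < 0 ↔
      -(2 - ε) * x 0 + 2 * (1 - ε) * x 1 - ε * x 2 < 0 := by
    rw [← mul_lt_mul_iff_left₀ hd]
    have e1 : (-pStar ε * x 0 + (1 - 2 * pStar ε) * x 1 + (1 - 3 * pStar ε) * x 2) *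
        (2 * (3 - 2 * ε)) = -(2 - ε) * x 0 + 2 * (1 - ε) * x 1 - ε * x 2 := by
      linear_combination (-x 0 - 2 * x 1 - 3 * x 2) * hp
    rw [e1, zero_mul]
  change _ ∧ _ ∧ _ ∧ _ ∧ _ ∧ _ ↔ _
  rw [h5, h6]

theorem bounds_of_mem_polytopeP {ε : ℝ} (h0 : 2 / 5 < ε) (h1 : ε < 1 / 2) {x : Pt}
    (hx : x ∈ polytopeP ε) :
    (0 < x 0 ∧ x 0 < 1 / 2) ∧ (0 < x 1 ∧ x 1 < 1 / 2) ∧ (0 < x 2 ∧ x 2 < 1 / 2) ∧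
      x 1 + x 2 < 1 / 2 ∧ x 0 + x 1 + x 2 < 1 := by
  obtain ⟨c0, c1, c2, c3, c4, c5⟩ := (mem_polytopeP_iff h1).1 hx
  have p0 : 0 < x 0 := by
    by_contra! hn
    nlinarith [mul_nonneg (by linarith : 0 ≤ 2 - ε) (by linarith : 0 ≤ -x 0)]
  have p1 : 0 < x 1 := by linarith
  have q0 : x 0 < 1 / 2 := by
    by_contra! hn
    nlinarith [mul_nonneg (by linarith : 0 ≤ 4 - 3 * ε) (by linarith : 0 ≤ x 0 - 1 / 2),
      mul_pos (by linarith : 0 < 1 - ε) p1]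
  have q12 : x 1 + x 2 < 1 / 2 := by
    by_contra! hn
    nlinarith
  exact ⟨⟨p0, q0⟩, ⟨p1, by linarith⟩, ⟨c1, by linarith⟩, q12, by linarith⟩

theorem polytopeP_subset_simplex {ε : ℝ} (h0 : 2 / 5 < ε) (h1 : ε < 1 / 2) :
    polytopeP ε ⊆ simplex := by
  intro x hx
  obtain ⟨a, b, c, -, d⟩ := bounds_of_mem_polytopeP h0 h1 hx
  exact ⟨a.1, b.1, c.1, d⟩

theorem simplex_subset_cube : simplex ⊆ cube := by
  intro x hx
  rw [← branch_zero x]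
  exact branch_mem_cube 0 hx

theorem isPolytope_polytopeP {ε : ℝ} (h0 : 2 / 5 < ε) (h1 : ε < 1 / 2) :
    IsPolytope (polytopeP ε) := by
  refine ⟨isBounded_cube.subset ((polytopeP_subset_simplex h0 h1).trans simplex_subset_cube), 6,
    ![![0, -1, 0], ![0, 0, -1], ![-1, -1, 0], ![1, 2, 3],
      ![4 - 3 * ε, 2 * (1 - ε), -ε], ![-(2 - ε), 2 * (1 - ε), -ε]],
    ![-(ε / 2), 0, -(ε / 2 * (3 - 2 * ε)), 1, 2 * (1 - ε), 0], ?_⟩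
  ext x
  rw [mem_polytopeP_iff h1, Set.mem_ofPred_eq]
  constructor
  · rintro ⟨c0, c1, c2, c3, c4, c5⟩ k
    fin_cases k <;> simp [Fin.sum_univ_three] <;> linarith
  · intro c
    have c0 := c 0
    have c1 := c 1
    have c2 := c 2
    have c3 := c 3
    have c4 := c 4
    have c5 := c 5
    simp [Fin.sum_univ_three] at c0 c1 c2 c3 c4 c5
    refine ⟨?_, ?_, ?_, ?_, ?_, ?_⟩ <;> linarith

/-! ### Words of the points of `P` -/

theorem mem_atom_of_mem_polytopeP {ε : ℝ} (h0 : 2 / 5 < ε) (h1 : ε < 1 / 2) {x : Pt}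
    (hx : x ∈ polytopeP ε) {a b : ℤ}
    (ha : (a : ℝ) - 1 / 2 < x 0 + x 1 ∧ x 0 + x 1 < a + 1 / 2)
    (hb : (b : ℝ) - 1 / 2 < x 0 + x 1 + x 2 ∧ x 0 + x 1 + x 2 < b + 1 / 2) :
    x ∈ atom ![0, 0, 0, a, 0, b] := by
  obtain ⟨⟨p0, q0⟩, ⟨p1, q1⟩, ⟨p2, q2⟩, q12, q⟩ := bounds_of_mem_polytopeP h0 h1 hx
  refine ⟨simplex_subset_cube (polytopeP_subset_simplex h0 h1 hx), ?_⟩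
  refine hasWord_iff.2 ⟨?_, ?_, ?_, ?_, ?_, ?_⟩
  all_goals first
    | exact ha
    | exact hb
    | (simp; constructor <;> linarith)

theorem word_of_mem {ε : ℝ} (h0 : 2 / 5 < ε) (h1 : ε < 1 / 2) {x : Pt} (hx : x ∈ polytopeP ε)
    {ω : Fin 6 → ℤ} (hω : x ∈ atom ω) :
    ω ∈ ({![0, 0, 0, 0, 0, 0], ![0, 0, 0, 0, 0, 1], ![0, 0, 0, 1, 0, 1]} :
      Set (Fin 6 → ℤ)) := by
  obtain ⟨⟨p0, q0⟩, ⟨p1, q1⟩, ⟨p2, q2⟩, q12, q⟩ := bounds_of_mem_polytopeP h0 h1 hx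
  have word_eq {j : Fin 6} {n : ℤ} (l : (n : ℝ) - 1 / 2 < sums x j)
      (r : sums x j < n + 1 / 2) : ω j = n := by
    rw [← h_eq_of_mem_atom hω j, h_eq_of_lt l r]
  have w0 : ω 0 = 0 := word_eq (by simp [sums]; linarith) (by simp [sums]; linarith)
  have w1 : ω 1 = 0 := word_eq (by simp [sums]; linarith) (by simp [sums]; linarith)
  have w2 : ω 2 = 0 := word_eq (by simp [sums]; linarith) (by simp [sums]; linarith)
  have w4 : ω 4 = 0 := word_eq (by simp [sums]; linarith) (by simp [sums]; linarith)
  have n3 : x 0 + x 1 ≠ 1 / 2 := by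
    have := sums_ne_of_mem_atom hω 3 0
    simpa [sums] using this
  have n5 : x 0 + x 1 + x 2 ≠ 1 / 2 := by
    have := sums_ne_of_mem_atom hω 5 0
    simpa [sums] using this
  have ext_word {a b : ℤ} (h3 : ω 3 = a) (h5 : ω 5 = b) : ω = ![0, 0, 0, a, 0, b] := by
    funext j
    fin_cases j
    exacts [w0, w1, w2, h3, w4, h5]
  rcases lt_or_gt_of_ne n3 with l3 | l3
  · have w3 : ω 3 = 0 := word_eq (by simp [sums]; linarith) (by simp [sums]; linarith)
    rcases lt_or_gt_of_ne n5 with l5 | l5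
    · exact Or.inl (ext_word w3 (word_eq (by simp [sums]; linarith) (by simp [sums]; linarith)))
    · exact Or.inr (Or.inl
        (ext_word w3 (word_eq (by simp [sums]; linarith) (by simp [sums]; linarith))))
  · have w3 : ω 3 = 1 := word_eq (by simp [sums]; linarith) (by simp [sums]; linarith)
    exact Or.inr (Or.inr
      (ext_word w3 (word_eq (by simp [sums]; linarith) (by simp [sums]; linarith))))

/-- Near the vertex `((1-ε)/2, ε/2, 0)` of the closure of `P`. -/
theorem exists_mem_polytopeP {ε : ℝ} (h0 : 0 < ε) (h1 : ε < 1 / 2) {d : Pt}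
    (hd0 : -2 ≤ d 0 ∧ d 0 ≤ 2) (hd1 : 0 < d 1 ∧ d 1 ≤ 2) (hd2 : 0 < d 2 ∧ d 2 ≤ 2) :
    ∃ t, 0 < t ∧ t ≤ 1 / 100 ∧
      ![(1 - ε) / 2 + t * d 0, ε / 2 + t * d 1, t * d 2] ∈ polytopeP ε := by
  have hs : 0 < 1 - 2 * ε := by linarith
  -- Only the first two faces pass through the base point. Among the slacks at the others are
  -- (1-2ε)(1-ε)/2 for the third and ε(1-ε)/2 for the fifth, so the step must be small against both
  -- ε and 1-2ε.
  have ht : 0 < ε * (1 - 2 * ε) / 100 := by positivity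
  have t1 : ε * (1 - 2 * ε) / 100 ≤ ε / 100 := by nlinarith
  have t2 : ε * (1 - 2 * ε) / 100 ≤ (1 - 2 * ε) / 200 := by nlinarith
  generalize ε * (1 - 2 * ε) / 100 = t at ht t1 t2
  refine ⟨t, ht, by linarith, (mem_polytopeP_iff h1).2 ?_⟩
  have a0 : t * d 0 ≤ 2 * t := by nlinarith
  have b0 : -(2 * t) ≤ t * d 0 := by nlinarith
  have a1 : 0 < t * d 1 := mul_pos ht hd1.1
  have b1 : t * d 1 ≤ 2 * t := by nlinarith
  have a2 : 0 < t * d 2 := mul_pos ht hd2.1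
  have b2 : t * d 2 ≤ 2 * t := by nlinarith
  generalize t * d 0 = u0 at *
  generalize t * d 1 = u1 at *
  generalize t * d 2 = u2 at *
  simp
  refine ⟨a1, a2, ?_, ?_, ?_, ?_⟩
  · nlinarith [mul_pos hs (by linarith : 0 < 1 / 2 - ε)]
  · linarith
  · nlinarith [mul_nonneg (by linarith : 0 ≤ 4 - 3 * ε) (by linarith : 0 ≤ 2 * t - u0),
      mul_nonneg (by linarith : 0 ≤ 1 - ε) (by linarith : 0 ≤ 2 * t - u1), mul_pos h0 a2,
      mul_pos h0 ht, mul_pos h0 hs]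
  · nlinarith [mul_nonneg (by linarith : 0 ≤ 2 - ε) (by linarith : 0 ≤ u0 + 2 * t),
      mul_nonneg (by linarith : 0 ≤ 1 - ε) (by linarith : 0 ≤ 2 * t - u1), mul_pos h0 a2,
      mul_pos h0 ht, mul_pos h0 hs, mul_pos hs hs]

theorem polytopeP_inter_atom_nonempty {ε : ℝ} (h0 : 2 / 5 < ε) (h1 : ε < 1 / 2) :
    (polytopeP ε ∩ atom ![0, 0, 0, 0, 0, 0]).Nonempty ∧
      (polytopeP ε ∩ atom ![0, 0, 0, 0, 0, 1]).Nonempty ∧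
      (polytopeP ε ∩ atom ![0, 0, 0, 1, 0, 1]).Nonempty := by
  have hε : 0 < ε := by linarith
  refine ⟨?_, ?_, ?_⟩
  -- All three pieces touch the base point, where x₁+x₂ = x₁+x₂+x₃ = 1/2; the signs of d₁+d₂ and
  -- d₁+d₂+d₃ select the piece.
  · obtain ⟨t, ht, ht', hx⟩ := exists_mem_polytopeP hε h1 (d := ![-2, 1 / 2, 1 / 2])
      (by norm_num) (by norm_num) (by simp; norm_num)
    refine ⟨_, hx, mem_atom_of_mem_polytopeP h0 h1 hx ?_ ?_⟩ <;> simp <;> constructor <;> linarith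
  · obtain ⟨t, ht, ht', hx⟩ := exists_mem_polytopeP hε h1 (d := ![-2, 1, 2])
      (by norm_num) (by norm_num) (by simp)
    refine ⟨_, hx, mem_atom_of_mem_polytopeP h0 h1 hx ?_ ?_⟩ <;> simp <;> constructor <;> linarith
  · obtain ⟨t, ht, ht', hx⟩ := exists_mem_polytopeP hε h1 (d := ![1, 1, 1])
      (by norm_num) (by norm_num) (by simp)
    refine ⟨_, hx, mem_atom_of_mem_polytopeP h0 h1 hx ?_ ?_⟩ <;> simp <;> constructor <;> linarith

/-! ### The images of the three pieces of `P` -/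

theorem G₃_of_mem_000000 {x : Pt} (hx : x ∈ atom ![0, 0, 0, 0, 0, 0]) (ε : ℝ) :
    G₃ ε x = ![2 * (1 - ε) * x 0, 2 * (1 - ε) * x 1, 2 * (1 - ε) * x 2] := by
  rw [HasWord.G₃_eq hx.2]
  simp

/-- The point of `P` whose image under `σ3124` is the image of a point of the atom `000001`. -/
noncomputable def preimage000001 (ε : ℝ) (x : Pt) : Pt :=
  ![2 * (1 - ε) * x 1, 1 - ε / 2 - 2 * (1 - ε) * (x 0 + x 1),
    2 * (1 - ε) * (x 0 + x 1 + x 2) + ε - 1]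

/-- The point of `P` whose image under `σ2134` is the image of a point of the atom `000101`. -/
noncomputable def preimage000101 (ε : ℝ) (x : Pt) : Pt :=
  ![1 - ε - 2 * (1 - ε) * x 0, 2 * (1 - ε) * (x 0 + x 1) + 3 * ε / 2 - 1, 2 * (1 - ε) * x 2]

theorem scaled_mem_polytopeP {ε : ℝ} (h0 : 2 / 5 < ε) (h1 : ε < 1 / 2)
    (h2 : ε ^ 2 - 5 * ε + 2 ≤ 0) {x : Pt} (hx : x ∈ polytopeP ε)
    (hs : x 0 + x 1 + x 2 < 1 / 2) :
    ![2 * (1 - ε) * x 0, 2 * (1 - ε) * x 1, 2 * (1 - ε) * x 2] ∈ polytopeP ε := by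
  obtain ⟨c0, c1, c2, c3, c4, c5⟩ := (mem_polytopeP_iff h1).1 hx
  have k1 : 0 < 1 - 2 * ε := by linarith
  have k2 : 0 < 1 - ε := by linarith
  have hε : 0 < ε := by linarith
  refine (mem_polytopeP_iff h1).2 ?_
  simp
  refine ⟨?_, by positivity, ?_, ?_, ?_, ?_⟩
  · nlinarith
  · have c2' : 0 < ε / 2 * (3 - 2 * ε) := mul_pos (by linarith) (by linarith)
    nlinarith [mul_pos k1 c2']
  · have m2 := mul_pos (by linarith : 0 < x 0 + x 1 - ε / 2 * (3 - 2 * ε)) k2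
    -- The bound 7/8 suffices because 2(1-ε)·7/8 < 1 for ε > 3/7, and 3/7 lies below (5-√17)/2.
    have key : 4 * (x 0 + 2 * x 1 + 3 * x 2) < 7 / 2 := by
      nlinarith
    nlinarith
  -- With S = x₁+x₂+x₃, the left side is (4-3ε)S - (2-ε)x₂ - (4-2ε)x₃, hence below (1-ε)(4-ε)/2,
  -- which is at most 1 by `h2`.
  · have key : (4 - 3 * ε) * x 0 + 2 * (1 - ε) * x 1 - ε * x 2 < 1 := by
      nlinarith [mul_pos (by linarith : 0 < 4 - 3 * ε) (by linarith : 0 < 1 / 2 - (x 0 + x 1 + x 2)),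
        mul_pos (by linarith : 0 < 2 - ε) (by linarith : 0 < x 1 - ε / 2)]
    nlinarith
  · nlinarith [mul_pos k2 (by linarith : 0 < -(-(2 - ε) * x 0 + 2 * (1 - ε) * x 1 - ε * x 2))]

theorem half_lt_of_mem_polytopeP {ε : ℝ} (h0 : 2 / 5 < ε) (h1 : ε < 1 / 2) {x : Pt}
    (hx : x ∈ polytopeP ε) : 1 / 2 < 2 * (1 - ε) * (x 0 + x 1) := by
  obtain ⟨-, -, c2, -⟩ := (mem_polytopeP_iff h1).1 hx
  -- The third face reduces the claim to ε(1-ε)(3-2ε) > 1/2, and the difference of the two sides is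
  -- (1-2ε)(2ε - ε² - 1/2).
  have k : 0 < 2 * ε - ε ^ 2 - 1 / 2 := by
    nlinarith [mul_pos (sub_pos.2 h0) (sub_pos.2 h1)]
  nlinarith [mul_pos (by linarith : 0 < 1 - 2 * ε) k,
    mul_pos (by linarith : 0 < 1 - ε) (by linarith : 0 < x 0 + x 1 - ε / 2 * (3 - 2 * ε))]

/-- The first two faces pull back to the walls x₁+x₂ = 1/2 and x₁+x₂+x₃ = 1/2, the fourth to itself
and the fifth to the sixth. The third becomes x₁ < (1-ε)/2, which follows from x₁+x₂ < 1/2 and x₂ >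
ε/2. -/
theorem preimage000001_mem {ε : ℝ} (h0 : 2 / 5 < ε) (h1 : ε < 1 / 2) {x : Pt}
    (hx : x ∈ polytopeP ε) (hs : x 0 + x 1 < 1 / 2) (ht : 1 / 2 < x 0 + x 1 + x 2) :
    preimage000001 ε x ∈ polytopeP ε := by
  obtain ⟨c0, c1, c2, c3, c4, c5⟩ := (mem_polytopeP_iff h1).1 hx
  have k2 : 0 < 1 - ε := by linarith
  refine (mem_polytopeP_iff h1).2 ?_
  simp [preimage000001]
  refine ⟨?_, ?_, ?_, ?_, ?_, ?_⟩
  · nlinarith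
  · nlinarith
  · nlinarith
  · nlinarith
  · nlinarith
  · nlinarith [mul_pos (mul_pos (by linarith : 0 < 4 - 3 * ε) k2) (by linarith : 0 < x 1 - ε / 2)]

/-- The faces match exactly: the first pulls back to the wall x₁+x₂ = 1/2, the third to the first,
the second and fourth to themselves, and the last two are exchanged. This needs no lower bound on ε.
-/
theorem preimage000101_mem {ε : ℝ} (h1 : ε < 1 / 2) {x : Pt}
    (hx : x ∈ polytopeP ε) (hs : 1 / 2 < x 0 + x 1) :
    preimage000101 ε x ∈ polytopeP ε := by
  obtain ⟨c0, c1, c2, c3, c4, c5⟩ := (mem_polytopeP_iff h1).1 hx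
  have k2 : 0 < 1 - ε := by linarith
  refine (mem_polytopeP_iff h1).2 ?_
  simp [preimage000101]
  refine ⟨?_, ?_, ?_, ?_, ?_, ?_⟩
  · nlinarith
  · nlinarith
  · nlinarith
  · nlinarith
  · nlinarith
  · nlinarith

theorem solvesConditioningProblem_polytopeP {ε : ℝ} (h0 : 2 / 5 < ε) (h1 : ε < 1 / 2)
    (h2 : ε ^ 2 - 5 * ε + 2 ≤ 0) : SolvesConditioningProblem ε (polytopeP ε) where
  isPolytope := isPolytope_polytopeP h0 h1
  subset_cube := (polytopeP_subset_simplex h0 h1).trans simplex_subset_cube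
  localization ω := by
    constructor
    · rintro ⟨x, hx, hω⟩
      exact word_of_mem h0 h1 hx hω
    · obtain ⟨n0, n1, n2⟩ := polytopeP_inter_atom_nonempty h0 h1
      rintro (rfl | rfl | rfl)
      exacts [n0, n1, n2]
  image_000000 := by
    rintro _ ⟨x, ⟨hx, hω⟩, rfl⟩
    have ht := (hasWord_iff.1 hω.2).2.2.2.2.2.2
    simp at ht
    rw [G₃_of_mem_000000 hω]
    have hz := scaled_mem_polytopeP h0 h1 h2 hx (by linarith)
    refine ⟨hz, mem_atom_of_mem_polytopeP h0 h1 hz ?_ ?_⟩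
    · have hl := half_lt_of_mem_polytopeP h0 h1 hx
      have hb := (bounds_of_mem_polytopeP h0 h1 hz)
      simp at hb ⊢
      constructor <;> linarith
    · have hl := half_lt_of_mem_polytopeP h0 h1 hx
      have hb := (bounds_of_mem_polytopeP h0 h1 hz)
      simp at hb ⊢
      constructor <;> linarith
  image_000001 := by
    rintro _ ⟨x, ⟨hx, hω⟩, rfl⟩
    obtain ⟨-, -, -, hs, -, ht⟩ := hasWord_iff.1 hω.2
    simp at hs ht
    have hz := preimage000001_mem h0 h1 hx (by linarith) (by linarith)
    refine ⟨_, hz, ?_⟩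
    rw [σ3124_eq_branch (polytopeP_subset_simplex h0 h1 hz), HasWord.G₃_eq hω.2]
    funext i
    fin_cases i <;> simp [branch, preimage000001] <;> ring
  image_000101 := by
    rintro _ ⟨x, ⟨hx, hω⟩, rfl⟩
    obtain ⟨-, -, -, hs, -, ht⟩ := hasWord_iff.1 hω.2
    simp at hs ht
    have hz := preimage000101_mem h1 hx (by linarith)
    refine ⟨_, hz, ?_⟩
    rw [σ2134_eq_branch (polytopeP_subset_simplex h0 h1 hz), HasWord.G₃_eq hω.2]
    funext i
    fin_cases i <;> simp [branch, preimage000101] <;> ring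

/-- For smaller `ε`, points of `P` near the vertex `((1-ε)/2, ε/2, 0)` leave `P`. -/
theorem discriminant_of_solves {ε : ℝ} (h0 : 0 ≤ ε) (h1 : ε < 1 / 2)
    (hP : SolvesConditioningProblem ε (polytopeP ε)) : ε ^ 2 - 5 * ε + 2 ≤ 0 := by
  by_contra! hδ
  have hs : 0 < 1 - 2 * ε := by linarith
  have ht : 0 < (1 - 2 * ε) * (ε ^ 2 - 5 * ε + 2) / 100 := by positivity
  have t1 : (1 - 2 * ε) * (ε ^ 2 - 5 * ε + 2) / 100 ≤ (ε ^ 2 - 5 * ε + 2) / 100 := by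
    nlinarith
  have t2 : (1 - 2 * ε) * (ε ^ 2 - 5 * ε + 2) / 100 ≤ (1 - 2 * ε) / 50 := by
    nlinarith [mul_nonneg hs.le h0, mul_nonneg (mul_nonneg hs.le h0) (by linarith : 0 ≤ 5 - ε)]
  generalize (1 - 2 * ε) * (ε ^ 2 - 5 * ε + 2) / 100 = t at ht t1 t2
  have tε : 0 ≤ t * ε := mul_nonneg ht.le h0
  have tε' : t * ε ≤ t / 2 := by nlinarith
  -- At ε = 0 the base point also lies on the fifth face; the displacement -2t in x₁ moves strictly
  -- inside it.
  have hx : ![(1 - ε) / 2 - 2 * t, ε / 2 + t / 2, t / 2] ∈ polytopeP ε := by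
    refine (mem_polytopeP_iff h1).2 ?_
    simp
    refine ⟨ht, ?_, ?_, ?_, ?_⟩
    · nlinarith [mul_pos hs hs]
    · linarith
    · nlinarith [mul_nonneg h0 hs.le]
    · nlinarith [mul_nonneg h0 hs.le, mul_pos hs hs]
  have hω : ![(1 - ε) / 2 - 2 * t, ε / 2 + t / 2, t / 2] ∈ atom ![0, 0, 0, 0, 0, 0] := by
    refine ⟨fun i => ?_, hasWord_iff.2 ?_⟩
    · fin_cases i <;> simp <;> constructor <;> linarith
    · simp
      refine ⟨⟨?_, ?_⟩, ⟨?_, ?_⟩, ⟨?_, ?_⟩, ⟨?_, ?_⟩, ⟨?_, ?_⟩, ?_, ?_⟩ <;> linarith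
  have hG := (hP.image_000000 (Set.mem_image_of_mem _ ⟨hx, hω⟩)).1
  rw [G₃_of_mem_000000 hω] at hG
  obtain ⟨-, -, -, -, h4, -⟩ := (mem_polytopeP_iff h1).1 hG
  simp at h4
  have h4' : (2 * (1 - ε)) * ((4 - 3 * ε) * ((1 - ε) / 2 - 2 * t) +
      2 * (1 - ε) * (ε / 2 + t / 2) - ε * (t / 2)) < (2 * (1 - ε)) * 1 := by linarith
  have h4'' := lt_of_mul_lt_mul_left h4' (by linarith)
  -- As t tends to 0 the left side of `h4''` tends to 1 + (ε²-5ε+2)/2; `t1` keeps the correction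
  -- smaller than this excess.
  nlinarith

theorem discriminant_iff {ε : ℝ} (h1 : ε < 1 / 2) :
    (5 - Real.sqrt 17) / 2 ≤ ε ↔ ε ^ 2 - 5 * ε + 2 ≤ 0 := by
  have hsq : Real.sqrt 17 ^ 2 = 17 := Real.sq_sqrt (by norm_num)
  have hnn : 0 ≤ Real.sqrt 17 := Real.sqrt_nonneg 17
  constructor
  · intro hε
    nlinarith [mul_nonneg (by linarith : 0 ≤ Real.sqrt 17 - (5 - 2 * ε))
      (by linarith : 0 ≤ Real.sqrt 17 + (5 - 2 * ε))]
  · intro hε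
    have : 5 - 2 * ε ≤ Real.sqrt 17 := Real.le_sqrt_of_sq_le (by nlinarith)
    linarith

/-! ### Invariance and asymmetry of the orbit -/

/-- The word of `branch k x` in terms of the word of `x`. -/
def branchWord (k : Fin 6) (w : Fin 6 → ℤ) : Fin 6 → ℤ :=
  ![![w 0, w 1, w 2, w 3, w 4, w 5],
    ![1 - w 0, w 3, w 2, 1 + w 1, w 5, 1 + w 4],
    ![w 3, 1 - w 1, w 4, 1 + w 0, 1 + w 2, 1 + w 5],
    ![1 - w 3, w 0, w 4, 1 - w 1, w 5, 1 + w 2],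
    ![w 1, 1 - w 3, w 5, 1 - w 0, 1 + w 2, 1 + w 4],
    ![1 - w 1, 1 - w 0, w 5, 2 - w 3, 1 + w 4, 2 + w 2]] k

/-- Each sum of `branch k x` is, up to sign and an integer, a sum of x, and the unit intervals
centred at integers are preserved by integer shifts and reflections. -/
theorem HasWord.branch {w : Fin 6 → ℤ} {x : Pt} (hx : HasWord w x) (k : Fin 6) :
    HasWord (branchWord k w) (branch k x) := by
  obtain ⟨⟨a0, b0⟩, ⟨a1, b1⟩, ⟨a2, b2⟩, ⟨a3, b3⟩, ⟨a4, b4⟩, a5, b5⟩ := hasWord_iff.1 hx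
  refine hasWord_iff.2 ?_
  fin_cases k <;> simp [branchWord, CoupledMaps.branch] <;>
    refine ⟨⟨?_, ?_⟩, ⟨?_, ?_⟩, ⟨?_, ?_⟩, ⟨?_, ?_⟩, ⟨?_, ?_⟩, ?_, ?_⟩ <;> linarith

theorem exists_word_of_branch_mem_atom {ε : ℝ} (h0 : 2 / 5 < ε) (h1 : ε < 1 / 2) {x : Pt}
    (hx : x ∈ polytopeP ε) {k : Fin 6} {ω : Fin 6 → ℤ} (hω : branch k x ∈ atom ω) :
    x ∈ atom ![0, 0, 0, 0, 0, 0] ∨ x ∈ atom ![0, 0, 0, 0, 0, 1] ∨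
      x ∈ atom ![0, 0, 0, 1, 0, 1] := by
  obtain ⟨⟨p0, q0⟩, ⟨p1, q1⟩, ⟨p2, q2⟩, q12, q⟩ := bounds_of_mem_polytopeP h0 h1 hx
  have n3 : x 0 + x 1 ≠ 1 / 2 := by
    intro e
    -- The first table picks the sum of `branch k x` equal to ±(x₁+x₂) modulo ℤ; the second gives
    -- the integer part of its forbidden value.
    refine sums_ne_of_mem_atom hω (![3, 1, 0, 0, 1, 3] k) (![0, 0, 0, 0, 0, 1] k) ?_
    fin_cases k <;> simp [sums, branch] <;> linarith
  have n5 : x 0 + x 1 + x 2 ≠ 1 / 2 := by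
    intro e
    refine sums_ne_of_mem_atom hω (![5, 4, 5, 4, 2, 2] k) (![0, 0, 1, 0, 0, 0] k) ?_
    fin_cases k <;> simp [sums, branch] <;> linarith
  rcases lt_or_gt_of_ne n3 with l3 | l3
  · rcases lt_or_gt_of_ne n5 with l5 | l5
    · left
      refine mem_atom_of_mem_polytopeP h0 h1 hx ?_ ?_ <;> simp <;> constructor <;> linarith
    · right; left
      refine mem_atom_of_mem_polytopeP h0 h1 hx ?_ ?_ <;> simp <;> constructor <;> linarith
  · right; right
    refine mem_atom_of_mem_polytopeP h0 h1 hx ?_ ?_ <;> simp <;> constructor <;> linarith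

theorem G₃_branch_000000 {x : Pt} (hx : x ∈ atom ![0, 0, 0, 0, 0, 0]) (ε : ℝ) (k : Fin 6) :
    G₃ ε (branch k x) =
      branch k ![2 * (1 - ε) * x 0, 2 * (1 - ε) * x 1, 2 * (1 - ε) * x 2] := by
  rw [(HasWord.branch hx.2 k).G₃_eq]
  funext i
  fin_cases k <;> fin_cases i <;> simp [branch, branchWord] <;> ring

/-- Equivariance: `G₃` acts on the branch index by right multiplication by `σ3124`, of index 3,
whatever k is. -/
theorem G₃_branch_000001 {x : Pt} (hx : x ∈ atom ![0, 0, 0, 0, 0, 1]) (ε : ℝ) (k : Fin 6) :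
    G₃ ε (branch k x) = branch (![3, 2, 5, 4, 0, 1] k) (preimage000001 ε x) := by
  rw [(HasWord.branch hx.2 k).G₃_eq]
  funext i
  fin_cases k <;> fin_cases i <;> simp [branch, branchWord, preimage000001] <;> ring

theorem G₃_branch_000101 {x : Pt} (hx : x ∈ atom ![0, 0, 0, 1, 0, 1]) (ε : ℝ) (k : Fin 6) :
    G₃ ε (branch k x) = branch (![1, 0, 4, 5, 2, 3] k) (preimage000101 ε x) := by
  rw [(HasWord.branch hx.2 k).G₃_eq]
  funext i
  fin_cases k <;> fin_cases i <;> simp [branch, branchWord, preimage000101] <;> ring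

theorem isIUP_Orb_polytopeP {ε : ℝ} (h0 : 2 / 5 < ε) (h1 : ε < 1 / 2)
    (h2 : ε ^ 2 - 5 * ε + 2 ≤ 0) : IsIUP ε (Orb (polytopeP ε)) := by
  have hs := polytopeP_subset_simplex h0 h1
  refine ⟨⟨orbitSets (polytopeP ε), ?_, ?_, rfl⟩, fun ω => ?_⟩
  · rw [orbitSets_eq hs]
    exact Set.finite_range _
  · rw [orbitSets_eq hs]
    rintro _ ⟨k, rfl⟩
    refine ⟨(isPolytope_polytopeP h0 h1).image_branch hs k, ?_⟩
    rintro _ ⟨x, hx, rfl⟩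
    exact branch_mem_cube k (hs hx)
  · rw [Orb_eq hs]
    rintro _ ⟨y, ⟨hy, hω⟩, rfl⟩
    obtain ⟨k, x, hx, rfl⟩ := Set.mem_iUnion.1 hy
    rcases exists_word_of_branch_mem_atom h0 h1 hx hω with hw | hw | hw
    · have ht := (hasWord_iff.1 hw.2).2.2.2.2.2.2
      simp at ht
      rw [G₃_branch_000000 hw]
      exact Set.mem_iUnion.2 ⟨_, _, scaled_mem_polytopeP h0 h1 h2 hx (by linarith), rfl⟩
    · obtain ⟨-, -, -, hs', -, ht⟩ := hasWord_iff.1 hw.2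
      simp at hs' ht
      rw [G₃_branch_000001 hw]
      exact Set.mem_iUnion.2
        ⟨_, _, preimage000001_mem h0 h1 hx (by linarith) (by linarith), rfl⟩
    · obtain ⟨-, -, -, hs', -⟩ := hasWord_iff.1 hw.2
      simp at hs'
      rw [G₃_branch_000101 hw]
      exact Set.mem_iUnion.2 ⟨_, _, preimage000101_mem h1 hx (by linarith), rfl⟩

/-- Inversion sends copy k to the copy k·5 (product in S₃), acting on the simplex as x ↦ (x₂, x₁,
1-x₁-x₂-x₃). This turns the value s of x₁+2x₂+3x₃ into 3-s, so both values cannot be below 1; other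
copies are disjoint. -/
theorem inversion_branch_ne {x z : Pt} (hx : x ∈ simplex) (hz : z ∈ simplex)
    (hx' : x 0 + 2 * x 1 + 3 * x 2 < 1) (hz' : z 0 + 2 * z 1 + 3 * z 2 < 1) (k l : Fin 6) :
    inversion (branch k x) ≠ branch l z := by
  obtain ⟨h0, h1, h2, h3⟩ := hx
  obtain ⟨g0, g1, g2, g3⟩ := hz
  intro e
  have e0 := congrFun e 0
  have e1 := congrFun e 1
  have e2 := congrFun e 2
  fin_cases k <;> fin_cases l <;> simp [branch, inversion] at e0 e1 e2 <;> linarith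

theorem inversion_Orb_inter_Orb {ε : ℝ} (h0 : 2 / 5 < ε) (h1 : ε < 1 / 2) :
    inversion '' Orb (polytopeP ε) ∩ Orb (polytopeP ε) = ∅ := by
  have hs := polytopeP_subset_simplex h0 h1
  rw [Orb_eq hs, Set.eq_empty_iff_forall_notMem]
  rintro _ ⟨⟨y, hy, rfl⟩, hy'⟩
  obtain ⟨k, x, hx, rfl⟩ := Set.mem_iUnion.1 hy
  obtain ⟨l, z, hz, e⟩ := Set.mem_iUnion.1 hy'
  exact inversion_branch_ne (hs hx) (hs hz) ((mem_polytopeP_iff h1).1 hx).2.2.2.1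
    ((mem_polytopeP_iff h1).1 hz).2.2.2.1 k l e.symm

end CoupledMaps

theorem mainTheorem3 (ε : ℝ) (hε₀ : 0 ≤ ε) (hε₁ : ε < 1 / 2) :
    (((CoupledMaps.polytopeP ε).Nonempty ∧
        CoupledMaps.SolvesConditioningProblem ε (CoupledMaps.polytopeP ε)) ↔
      ε ∈ Set.Ico ((5 - Real.sqrt 17) / 2) (1 / 2)) ∧
    (ε ∈ Set.Ico ((5 - Real.sqrt 17) / 2) (1 / 2) →
      (CoupledMaps.orbitSets (CoupledMaps.polytopeP ε)).ncard = 6 ∧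
      CoupledMaps.IsAsIUP ε (CoupledMaps.Orb (CoupledMaps.polytopeP ε))) := by
  have hmem : ε ∈ Set.Ico ((5 - Real.sqrt 17) / 2) (1 / 2) ↔ ε ^ 2 - 5 * ε + 2 ≤ 0 :=
    ⟨fun hε => (CoupledMaps.discriminant_iff hε₁).1 hε.1,
      fun hε => ⟨(CoupledMaps.discriminant_iff hε₁).2 hε, hε₁⟩⟩
  -- The quadratic decreases on [0, 1/2) and equals 4/25 at 2/5.
  have hlow : ε ^ 2 - 5 * ε + 2 ≤ 0 → 2 / 5 < ε := fun hε => by nlinarith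
  rw [hmem]
  refine ⟨⟨fun hP => CoupledMaps.discriminant_of_solves hε₀ hε₁ hP.2, fun hε => ?_⟩,
    fun hε => ?_⟩
  · exact ⟨(CoupledMaps.polytopeP_inter_atom_nonempty (hlow hε) hε₁).1.left,
      CoupledMaps.solvesConditioningProblem_polytopeP (hlow hε) hε₁ hε⟩
  · exact ⟨CoupledMaps.ncard_orbitSets (CoupledMaps.polytopeP_subset_simplex (hlow hε) hε₁)
        (CoupledMaps.polytopeP_inter_atom_nonempty (hlow hε) hε₁).1.left,
      CoupledMaps.isIUP_Orb_polytopeP (hlow hε) hε₁ hε,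
      CoupledMaps.inversion_Orb_inter_Orb (hlow hε) hε₁⟩
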